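/- Let a power grid consist of a finite set $\mathcal N$ of buses and a finite set $\mathcal L$ of transmission lines, each line $l$ joining two distinct buses $n,m$ and having a reactance $x_l$. Let $\mathbf m_l\in\mathbb R^{\mathcal N}$ be the incidence vector of $l$ (entry $1$ at $n$, $-1$ at $m$, $0$ elsewhere) and $\mathbf B=\sum_{l\in\mathcal L}\frac1{x_l}\mathbf m_l\mathbf m_l^{T}$ the weighted Laplacian. Assume that the graph $\mathcal G$ of the grid is connected and that the reactances $x_l$ $(l\in\mathcal L)$ are independent (not necessarily identically distributed) real random variables with continuous distributions, i.e. $\Pr(x_l=c)=0$ for every $c\in\mathbb R$, and that they are bounded below by a positive constant almost surely. Fix a nonempty set $\mathcal M\subseteq\mathcal N$ (buses with PMUs) and a set $\mathcal U\subseteq\mathcal N$ (unalterable buses). An unobservable attack is a vector $\Delta\mathbf P\ne\mathbf 0$ in $\mathbb R^{\mathcal N}$ that vanishes on $\mathcal U$ and for which there is $\Delta\boldsymbol\theta\in\mathbb R^{\mathcal N}$ with $\Delta\mathbf P=\mathbf B\,\Delta\boldsymbol\theta$ and $\Delta\boldsymbol\theta_{\mathcal M}=\mathbf 0$. Its sparsity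 is the number $\|\Delta\mathbf P\|_0$ of its nonzero entries. The augmented graph $\mathcal G^{\mathcal M}$ is obtained from $\mathcal G$ by adding one dummy bus, which is unalterable, and an edge between every two distinct elements of $\bar{\mathcal M}=\mathcal M\cup\{\text{dummy bus}\}$. A vertex cut of $\mathcal G^{\mathcal M}$ is a set $C$ of vertices whose removal leaves a disconnected graph; let $\mathcal S_C$ be the set of vertices outside $C$ that are then disconnected from all the remaining elements of $\bar{\mathcal M}$. The cut $C$ is vulnerable if $\mathcal S_C\cup C$ contains at least $|C|+1$ alterable buses (buses of $\mathcal N\setminus\mathcal U$). Let $\bar\kappa(\mathcal G^{\mathcal M})$ be the minimum size of a vulnerable vertex cut of $\mathcal G^{\mathcal M}$, and $\infty$ if there is none. Then, with probability one, the minimum sparsity of an unobservable attack ($\infty$ if there is none) equals $\bar\kappa(\mathcal G^{\mathcal M})+1$. The same holds for the optimum of the problem: minimize $\|\mathbf B\,\Delta\boldsymbol\theta\|_0$ over all $\Delta\boldsymbol\theta\neq\mathbf 0$ with $\Delta\boldsymbol\theta_{\mathcal M}=\mathbf 0$ and $(\mathbf B\,\Delta\boldsymbol\theta)_{\mathcal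 U}=\mathbf 0$. -/

import Mathlib

open MeasureTheory ProbabilityTheory

noncomputable section

/-- A power network: a finite set `N` of buses and a finite set `L` of transmission lines, each of
which connects two distinct buses. The orientation of a line is an arbitrary choice. Parallel lines
are allowed. -/
structure PowerGrid (N L : Type*) where
  /-- first end of a line -/
  src : L → N
  /-- second end of a line -/
  dst : L → N
  src_ne_dst : ∀ l, src l ≠ dst l

namespace PowerGrid

section Network

variable {N L : Type*} (G : PowerGrid N L)

/-- The (unweighted) graph of the network: two buses are adjacent when a line connects them. -/
def graph : SimpleGraph N where
  Adj n m := ∃ l, (G.src l = n ∧ G.dst l = m) ∨ (G.src l = m ∧ G.dst l = n)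
  symm := ⟨fun _ _ ⟨l, h⟩ => ⟨l, h.symm⟩⟩
  loopless := ⟨fun _ ⟨l, h⟩ => by
    rcases h with ⟨h1, h2⟩ | ⟨h1, h2⟩ <;> exact G.src_ne_dst l (h1.trans h2.symm)⟩

/-- The incidence vector of a line: `1` at its first end, `-1` at its second end, `0` elsewhere. -/
def incidence [DecidableEq N] (l : L) : N → ℝ := fun i =>
  if i = G.src l then 1 else if i = G.dst l then -1 else 0

/-- The Laplacian `B = ∑ l, (1 / x l) • m_l m_lᵀ` for the line reactances `x`. -/
def laplacian [DecidableEq N] [Fintype L] (x : L → ℝ) : Matrix N N ℝ :=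
  ∑ l, (1 / x l) • Matrix.vecMulVec (G.incidence l) (G.incidence l)

end Network

section Attack

variable {N L : Type*} [Fintype N] [DecidableEq N] [Fintype L] (G : PowerGrid N L)

open Matrix in
/-- `ΔP` is a (nonzero) power injection attack that alters no bus of `U` and is unobservable by
the PMUs at `M`, for the line reactances `x`. -/
def IsUnobservableAttack (x : L → ℝ) (M U : Finset N) (ΔP : N → ℝ) : Prop :=
  ΔP ≠ 0 ∧ (∀ n ∈ U, ΔP n = 0) ∧
    ∃ Δθ : N → ℝ, ΔP = G.laplacian x *ᵥ Δθ ∧ ∀ n ∈ M, Δθ n = 0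

/-- The minimum number of nonzero entries of an unobservable attack; `⊤` if there is none. -/
def minAttackSparsity (x : L → ℝ) (M U : Finset N) : ℕ∞ :=
  ⨅ (ΔP : N → ℝ) (_ : G.IsUnobservableAttack x M U ΔP), (hammingNorm ΔP : ℕ∞)

open Matrix in
/-- The optimum of the problem: minimize `‖B Δθ‖₀` over all `Δθ ≠ 0` that vanish on `M` and for
which `B Δθ` vanishes on `U`; `⊤` if the problem is infeasible. -/
def sparsestAttackOptimum (x : L → ℝ) (M U : Finset N) : ℕ∞ :=
  ⨅ (Δθ : N → ℝ) (_ : Δθ ≠ 0 ∧ (∀ n ∈ M, Δθ n = 0) ∧ ∀ n ∈ U, (G.laplacian x *ᵥ Δθ) n = 0),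
    (hammingNorm (G.laplacian x *ᵥ Δθ) : ℕ∞)

end Attack

end PowerGrid

/-- The augmented vertex set `M̄`: the buses in `M` and the dummy bus `none`. -/
def augmentedSet {N : Type*} (M : Finset N) : Set (Option N) :=
  {v | v = none ∨ ∃ n ∈ M, v = some n}

/-- The augmented graph: one dummy bus `none` is added to the buses, and an edge is added between
every two distinct elements of `M̄`. -/
def augmentedGraph {N : Type*} (H : SimpleGraph N) (M : Finset N) : SimpleGraph (Option N) where
  Adj u v := (∃ n m, u = some n ∧ v = some m ∧ H.Adj n m) ∨
    (u ≠ v ∧ u ∈ augmentedSet M ∧ v ∈ augmentedSet M)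
  symm := ⟨fun _ _ h => by
    rcases h with ⟨n, m, hn, hm, h⟩ | ⟨h, hu, hv⟩
    · exact Or.inl ⟨m, n, hm, hn, h.symm⟩
    · exact Or.inr ⟨h.symm, hv, hu⟩⟩
  loopless := ⟨fun v h => by
    rcases h with ⟨n, m, hn, hm, h⟩ | ⟨h, _⟩
    · exact H.ne_of_adj h (Option.some.inj (hn.symm.trans hm))
    · exact h rfl⟩

/-- The graph that remains after the removal of the vertices in `C`. -/
def removeVertices {W : Type*} (H : SimpleGraph W) (C : Finset W) : SimpleGraph {w // w ∉ C} :=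
  H.comap Subtype.val

/-- A vertex cut: a set of vertices whose removal leaves a disconnected graph. -/
def IsVertexCut {W : Type*} (H : SimpleGraph W) (C : Finset W) : Prop :=
  ¬ (removeVertices H C).Preconnected

/-- The vertices outside `C` that are disconnected from `T` once `C` is removed. -/
def separatedFrom {W : Type*} (H : SimpleGraph W) (T : Set W) (C : Finset W) : Set W :=
  {v | ∃ hv : v ∉ C, ∀ t, ∀ ht : t ∉ C, t ∈ T → ¬ (removeVertices H C).Reachable ⟨v, hv⟩ ⟨t, ht⟩}

/-- A vulnerable vertex cut of the augmented graph: with `S` the set of buses that the cut `C`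
disconnects from `M̄`, at least `|C| + 1` elements of `S ∪ C` are alterable. The alterable buses are
the buses outside `U`; the dummy bus is unalterable. -/
def IsVulnerableVertexCut {N : Type*} (H : SimpleGraph N) (M U : Finset N)
    (C : Finset (Option N)) : Prop :=
  IsVertexCut (augmentedGraph H M) C ∧
    C.card + 1 ≤ {n : N | n ∉ U ∧
      some n ∈ separatedFrom (augmentedGraph H M) (augmentedSet M) C ∪ (C : Set (Option N))}.ncard

/-- The vulnerable vertex connectivity: the minimum size of a vulnerable vertex cut of the
augmented graph; `⊤` if there is none. -/
def vulnerableVertexConnectivity {N : Type*} (H : SimpleGraph N) (M U : Finset N) : ℕ∞ :=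
  ⨅ (C : Finset (Option N)) (_ : IsVulnerableVertexCut H M U C), (C.card : ℕ∞)

end

/-!
Write `B` for the Laplacian with the line weights `y = 1 / x`. A state change `θ` that vanishes on `M`
and for which `B θ` is supported on `A` is called an attack on `A`. The theorem compares the sets `A`
that admit an attack for generic weights with the vulnerable vertex cuts.

*Cuts give attacks.* Let `C` be a vulnerable cut that separates `S` from `M`. State changes supported
on `S` alter injections on `S ∪ C` only. Choosing `|C| + 1` alterable buses in `S ∪ C` and asking that
the others be unaltered leaves at most `|S| - 1` equations for `|S|` unknowns. This holds for all
positive weights (`PowerGrid.exists_hammingNorm_le`).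

*Attacks give cuts.* Let `A` be the support of `B θ`, and apply Hall's theorem to the closed
neighbourhoods `N[v]`, `v ∉ M`, with the elements of `A` removed
(`SimpleGraph.exists_injective_or_card_lt`).
If some `S` violates Hall's condition, `|N[S] \ A| < |S|`, then `C = N[S] \ S` separates `S` from `M`
and `|C| < |N[S] ∩ A|`, so `C` is vulnerable and `|C| + 1 ≤ |A|`
(`vulnerableVertexConnectivity_add_one_le`).
Otherwise there is a matching of the complement of `M` into the complement of `A`. It yields a spanning
forest whose trees contain exactly one element of `M` and at most one element of `A` each
(`SimpleGraph.Connected.exists_parent_map`), and for the weights that are `1` inside the trees and `0`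
between them there is no attack on `A` (`PowerGrid.exists_noAttackOn_of_parent_map`). The existence
of an attack on `A` means that a certain determinant vanishes, which is a polynomial in the weights
(`PowerGrid.det_attackMatrix_ne_zero_iff`). This polynomial is not zero, so it is almost surely nonzero
at independent weights with continuous distributions
(`MvPolynomial.ae_eval_ne_zero_of_iIndepFun`): almost surely, the second case does not occur.
-/

/-! ### Polynomials in independent random variables with continuous distributions -/

/-- Replacing the coordinates of a non-root of `p` one after the other by the random variables `y i`
almost surely never produces a root: with the other coordinates fixed, `p` is a nonzero polynomial
in the new coordinate, so only finitely many of its values are bad, and by independence they may be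
considered fixed. -/
theorem MvPolynomial.ae_eval_ne_zero_of_iIndepFun {ι Ω : Type*} [Fintype ι]
    [MeasurableSpace Ω] {P : Measure Ω} [IsProbabilityMeasure P] {y : ι → Ω → ℝ}
    (hy_meas : ∀ i, Measurable (y i)) (hy_indep : iIndepFun y P)
    (hy_cont : ∀ i, ∀ c : ℝ, P {ω | y i ω = c} = 0)
    {p : MvPolynomial ι ℝ} (hp : ∃ y₀, MvPolynomial.eval y₀ p ≠ 0) :
    ∀ᵐ ω ∂P, MvPolynomial.eval (fun i => y i ω) p ≠ 0 := by
  classical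
  obtain ⟨y₀, hy₀⟩ := hp
  let Z : Finset ι → Ω → ι → ℝ := fun s ω i => if i ∈ s then y i ω else y₀ i
  have hZ_meas (s : Finset ι) : Measurable (Z s) := by
    refine measurable_pi_lambda _ fun i => ?_
    by_cases hi : i ∈ s
    · simpa [Z, hi] using hy_meas i
    · simp [Z, hi]
  have hp_cont : Continuous fun z : ι → ℝ => MvPolynomial.eval z p := MvPolynomial.continuous_eval p
  suffices h : ∀ s : Finset ι, ∀ᵐ ω ∂P, MvPolynomial.eval (Z s ω) p ≠ 0 by
    simpa [Z] using h Finset.univ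
  intro s
  induction s using Finset.induction_on with
  | empty => simpa [Z] using hy₀
  | insert i s hi ih =>
    have hind : IndepFun (Z s) (y i) P := by
      have h := hy_indep.indepFun_finset s {i} (by simpa using hi) hy_meas
      have hφ : Measurable fun (u : s → ℝ) (j : ι) =>
          if hj : j ∈ s then u ⟨j, hj⟩ else y₀ j := by
        refine measurable_pi_lambda _ fun j => ?_
        by_cases hj : j ∈ s
        · simpa [hj] using measurable_pi_apply _
        · simp [hj]
      have hψ : Measurable fun u : ({i} : Finset ι) → ℝ => u ⟨i, by simp⟩ :=
        measurable_pi_apply _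
      have h' := h.comp hφ hψ
      convert h' using 1
      · funext ω j
        simp [Z]
      · rfl
    have hlaw := hind.map_prod_eq_prod_map_map (hZ_meas s).aemeasurable (hy_meas i).aemeasurable
    have hupd : Measurable fun q : (ι → ℝ) × ℝ => Function.update q.1 i q.2 := by
      fun_prop
    have hset : MeasurableSet
        {q : (ι → ℝ) × ℝ | MvPolynomial.eval (Function.update q.1 i q.2) p ≠ 0} :=
      (hp_cont.measurable.comp hupd) (measurableSet_singleton 0).compl
    have hZ_insert (ω : Ω) : Z (insert i s) ω = Function.update (Z s ω) i (y i ω) := by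
      funext j
      by_cases hj : j = i
      · subst hj; simp [Z]
      · simp [Z, hj]
    suffices h : ∀ᵐ q ∂P.map (fun ω => (Z s ω, y i ω)),
        MvPolynomial.eval (Function.update q.1 i q.2) p ≠ 0 by
      have := ae_of_ae_map ((hZ_meas s).prodMk (hy_meas i)).aemeasurable h
      simpa only [hZ_insert] using this
    have := Measure.isProbabilityMeasure_map (μ := P) (hy_meas i).aemeasurable
    rw [hlaw, Measure.ae_prod_iff_ae_ae hset]
    have hset' : MeasurableSet {z : ι → ℝ | MvPolynomial.eval z p ≠ 0} :=
      hp_cont.measurable (measurableSet_singleton 0).compl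
    filter_upwards [(ae_map_iff (hZ_meas s).aemeasurable hset').2 ih] with z hz
    let r : Polynomial ℝ :=
      MvPolynomial.aeval (Function.update (fun j => Polynomial.C (z j)) i Polynomial.X) p
    have hr (t : ℝ) : r.eval t = MvPolynomial.eval (Function.update z i t) p := by
      have h : ((Polynomial.aeval t).comp (MvPolynomial.aeval
          (Function.update (fun j => Polynomial.C (z j)) i Polynomial.X)) :
            MvPolynomial ι ℝ →ₐ[ℝ] ℝ) = MvPolynomial.aeval (Function.update z i t) := by
        ext j
        by_cases hj : j = i
        · subst hj; simp
        · simp [hj]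
      have h' := DFunLike.congr_fun h p
      simpa [r, Polynomial.coe_aeval_eq_eval, MvPolynomial.coe_aeval_eq_eval] using h'
    have hr0 : r ≠ 0 := by
      intro h0
      have := hr (z i)
      rw [h0, Function.update_eq_self] at this
      exact hz (by simpa using this.symm)
    refine measure_mono_null (t := (r.roots.toFinset : Set ℝ)) (fun t ht => ?_) ?_
    · have ht' : MvPolynomial.eval (Function.update z i t) p = 0 := by simpa using ht
      simpa [hr0] using (hr t).trans ht'
    · rw [← Set.biUnion_of_singleton (r.roots.toFinset : Set ℝ),
        measure_biUnion_null_iff (Finset.countable_toSet _)]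
      intro t _
      rw [Measure.map_apply (hy_meas i) (measurableSet_singleton t)]
      exact hy_cont i t

/-! ### Hall's theorem and rooted forests -/

/-- The closed neighbourhood of the set `S`. -/
noncomputable def SimpleGraph.closedNeighborFinset {V : Type*} [Fintype V] (H : SimpleGraph V)
    (S : Finset V) : Finset V :=
  open Classical in {w | ∃ v ∈ S, w = v ∨ H.Adj v w}

theorem SimpleGraph.mem_closedNeighborFinset {V : Type*} [Fintype V] {H : SimpleGraph V}
    {S : Finset V} {w : V} :
    w ∈ H.closedNeighborFinset S ↔ ∃ v ∈ S, w = v ∨ H.Adj v w := by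
  simp [closedNeighborFinset]

theorem SimpleGraph.subset_closedNeighborFinset {V : Type*} [Fintype V] (H : SimpleGraph V)
    (S : Finset V) : S ⊆ H.closedNeighborFinset S :=
  fun v hv => mem_closedNeighborFinset.2 ⟨v, hv, Or.inl rfl⟩

/-- Hall's theorem for the closed neighbourhoods of the vertices outside `M`, with the elements of
`A` removed: either there is a matching, or some `S` violates Hall's condition. -/
theorem SimpleGraph.exists_injective_or_card_lt {V : Type*} [Fintype V] [DecidableEq V]
    (H : SimpleGraph V) (M A : Finset V) :
    (∃ f : {v // v ∉ M} → V, Function.Injective f ∧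
      ∀ v, f v ∉ A ∧ (f v = v ∨ H.Adj v (f v))) ∨
    ∃ S : Finset V, Disjoint S M ∧ (H.closedNeighborFinset S \ A).card < S.card := by
  let t : {v // v ∉ M} → Finset V := fun v => H.closedNeighborFinset {v.1} \ A
  by_cases h : ∀ s : Finset {v // v ∉ M}, s.card ≤ (s.biUnion t).card
  · left
    obtain ⟨f, hf, hft⟩ := (Finset.all_card_le_biUnion_card_iff_exists_injective t).1 h
    refine ⟨f, hf, fun v => ?_⟩
    have := hft v
    simp only [t, Finset.mem_sdiff, mem_closedNeighborFinset, Finset.mem_singleton,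
      exists_eq_left] at this
    exact ⟨this.2, this.1⟩
  · right
    push Not at h
    obtain ⟨s, hs⟩ := h
    refine ⟨s.map (Function.Embedding.subtype _), ?_, ?_⟩
    · rw [Finset.disjoint_left]
      intro v hv
      obtain ⟨w, -, rfl⟩ := Finset.mem_map.1 hv
      exact w.2
    · rw [Finset.card_map]
      refine lt_of_eq_of_lt (congrArg Finset.card ?_) hs
      ext w
      simp only [t, Finset.mem_sdiff, Finset.mem_biUnion, mem_closedNeighborFinset,
        Finset.mem_map, Finset.mem_singleton]
      aesop

/-- Follow `f` from two points of `A` up to the first visit of `M`. If both end in the same place,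
then walking back (`f` is injective and never enters `A`) shows that the points are equal. -/
theorem eq_of_iterate_eq_of_notMem {V : Type*} {M A : Set V} {g : V → V}
    (hg_inj : Set.InjOn g Mᶜ) (hg_A : ∀ v ∉ M, g v ∉ A) {a b : V} (ha : a ∈ A) (hb : b ∈ A)
    (k l : ℕ) (hk : ∀ j < k, g^[j] a ∉ M) (hl : ∀ j < l, g^[j] b ∉ M)
    (h : g^[k] a = g^[l] b) : a = b := by
  induction k generalizing l with
  | zero =>
    cases l with
    | zero => exact h
    | succ l =>
      rw [Function.iterate_succ_apply'] at h
      exact absurd (h ▸ ha : g (g^[l] b) ∈ A) (hg_A _ (hl l l.lt_succ_self))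
  | succ k ih =>
    cases l with
    | zero =>
      rw [Function.iterate_succ_apply'] at h
      exact absurd (h ▸ hb : g (g^[k] a) ∈ A) (hg_A _ (hk k k.lt_succ_self))
    | succ l =>
      rw [Function.iterate_succ_apply', Function.iterate_succ_apply'] at h
      exact ih l (fun j hj => hk j (by omega)) (fun j hj => hl j (by omega))
        (hg_inj (hk k k.lt_succ_self) (hl l l.lt_succ_self) h)

theorem SimpleGraph.Connected.exists_adj_dist_lt {V : Type*} {H : SimpleGraph V}
    (hH : H.Connected) {v m : V} (hv : v ≠ m) : ∃ w, H.Adj v w ∧ H.dist w m < H.dist v m := by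
  obtain ⟨p, hp⟩ := hH.exists_walk_length_eq_dist v m
  cases p with
  | nil => exact absurd rfl hv
  | cons hadj q =>
    refine ⟨_, hadj, ?_⟩
    have := SimpleGraph.dist_le q
    rw [SimpleGraph.Walk.length_cons] at hp
    omega

/-- A matching of `V \ M` into `V \ A` along edges and loops yields a spanning forest, encoded by
its parent map `h`: the roots `h^[K] v` are the elements of `M`, and the elements of `A` lie in
different trees. The orbits of the matching that reach `M` are kept as branches; on the other
orbits, which avoid `A`, a shortest path towards `M` is followed instead. -/
theorem SimpleGraph.Connected.exists_parent_map {V : Type*} [Fintype V] {H : SimpleGraph V}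
    (hH : H.Connected) {M A : Finset V} (hM : M.Nonempty) {f : {v // v ∉ M} → V}
    (hf_inj : Function.Injective f) (hf : ∀ v, f v ∉ A ∧ (f v = v ∨ H.Adj v (f v))) :
    ∃ (h : V → V) (K : ℕ), (∀ m ∈ M, h m = m) ∧ (∀ v ∉ M, H.Adj v (h v)) ∧
      (∀ v, h^[K] v ∈ M) ∧ Set.InjOn h^[K] A := by
  classical
  obtain ⟨m₀, hm₀⟩ := hM
  let g : V → V := fun v => if hv : v ∈ M then v else f ⟨v, hv⟩
  have hg_M : ∀ m ∈ M, g m = m := fun m hm => by simp [g, hm]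
  have hg_inj : Set.InjOn g (M : Set V)ᶜ := by
    intro v hv w hw h
    have hv' : v ∉ M := hv
    have hw' : w ∉ M := hw
    simpa using hf_inj (show f ⟨v, hv'⟩ = f ⟨w, hw'⟩ by simpa [g, hv', hw'] using h)
  have hg_A : ∀ v ∉ (M : Set V), g v ∉ (A : Set V) := by
    intro v hv
    have hv' : v ∉ M := hv
    simpa [g, hv'] using (hf ⟨v, hv'⟩).1
  let Q : Set V := {v | ∃ k, g^[k] v ∈ M}
  have hM_Q : ∀ m ∈ M, m ∈ Q := fun m hm => ⟨0, hm⟩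
  have hg_Q : ∀ v ∈ Q, g v ∈ Q := by
    rintro v ⟨k, hk⟩
    refine ⟨k, ?_⟩
    rw [← Function.iterate_succ_apply, Function.iterate_succ_apply', hg_M _ hk]
    exact hk
  -- An orbit that avoids `M` is periodic because `g` is injective outside `M`, so each of its points
  -- is a value of `g`, and none lies in `A`.
  have hA_Q : ∀ a ∈ A, a ∈ Q := by
    intro a ha
    by_contra haQ
    have hnot : ∀ j, g^[j] a ∉ (M : Set V) := fun j hj => haQ ⟨j, hj⟩
    obtain ⟨i, j, hij, heq⟩ := Finite.exists_ne_map_eq_of_infinite fun j => g^[j] a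
    wlog hlt : i < j generalizing i j
    · exact this j i hij.symm heq.symm (by omega)
    have key : ∀ i d, g^[i] a = g^[i + (d + 1)] a → False := by
      intro i
      induction i with
      | zero =>
        intro d h
        rw [zero_add, Function.iterate_succ_apply'] at h
        exact hg_A _ (hnot d) (h ▸ ha)
      | succ i ih =>
        intro d h
        rw [show i + 1 + (d + 1) = (i + (d + 1)) + 1 by ring, Function.iterate_succ_apply',
          Function.iterate_succ_apply'] at h
        exact ih d (hg_inj (hnot _) (hnot _) h)
    exact key i (j - i - 1) (by rw [show i + (j - i - 1 + 1) = j by omega]; exact heq)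
  have hstep : ∀ v, v ∉ Q → ∃ w, H.Adj v w ∧ H.dist w m₀ < H.dist v m₀ := fun v hv =>
    hH.exists_adj_dist_lt fun h => hv (h ▸ hM_Q m₀ hm₀)
  choose! c hc_adj hc_dist using hstep
  let h : V → V := fun v => if v ∈ Q then g v else c v
  have hh_Q : ∀ v ∈ Q, h v = g v := fun v hv => by simp [h, hv]
  have hh_M : ∀ m ∈ M, h m = m := fun m hm => (hh_Q m (hM_Q m hm)).trans (hg_M m hm)
  have hh_iter : ∀ k, ∀ v ∈ Q, h^[k] v = g^[k] v := by
    intro k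
    induction k with
    | zero => intro v _; rfl
    | succ k ih =>
      intro v hv
      rw [Function.iterate_succ_apply, Function.iterate_succ_apply, hh_Q v hv, ih _ (hg_Q v hv)]
  have hh_reach : ∀ v, ∃ k, h^[k] v ∈ M := by
    intro v
    induction hd : H.dist v m₀ using Nat.strong_induction_on generalizing v with
    | _ d ih =>
      by_cases hv : v ∈ Q
      · obtain ⟨k, hk⟩ := id hv
        exact ⟨k, by rwa [hh_iter k v hv]⟩
      · obtain ⟨k, hk⟩ := ih _ (hd ▸ hc_dist v hv) (c v) rfl
        exact ⟨k + 1, by simpa [h, hv] using hk⟩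
  have hh_fix : ∀ k, ∀ m ∈ M, h^[k] m = m := fun k m hm =>
    Function.iterate_fixed (hh_M m hm) k
  choose k hk using hh_reach
  let K := Finset.univ.sup k
  have hK : ∀ v, h^[K] v = h^[k v] v := by
    intro v
    have hle : k v ≤ K := Finset.le_sup (Finset.mem_univ v)
    conv_lhs => rw [← Nat.sub_add_cancel hle, Function.iterate_add_apply, hh_fix _ _ (hk v)]
  refine ⟨h, K, hh_M, ?_, fun v => (hK v).symm ▸ hk v, ?_⟩
  · intro v hv
    by_cases hvQ : v ∈ Q
    · have hgv : g v = f ⟨v, hv⟩ := by simp [g, hv]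
      rw [hh_Q v hvQ, hgv]
      refine (hf ⟨v, hv⟩).2.resolve_left fun hfix => ?_
      obtain ⟨j, hj⟩ := hvQ
      rw [Function.iterate_fixed (hgv.trans hfix) j] at hj
      exact hv hj
    · simpa [h, hvQ] using hc_adj v hvQ
  · intro a ha b hb hab
    have hfirst : ∀ a ∈ A, ∃ j, (∀ i < j, g^[i] a ∉ (M : Set V)) ∧ g^[j] a = h^[K] a := by
      intro a ha
      obtain ⟨k', hk'⟩ := id (hA_Q a ha)
      have hex : ∃ j, g^[j] a ∈ M := ⟨k', hk'⟩
      refine ⟨Nat.find hex, fun i hi => Nat.find_min hex hi, ?_⟩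
      have hle : Nat.find hex ≤ k a := by
        refine Nat.find_min' hex ?_
        rw [← hh_iter _ a (hA_Q a ha)]
        exact hk a
      have hmem : h^[Nat.find hex] a ∈ M := by
        rw [hh_iter _ a (hA_Q a ha)]
        exact Nat.find_spec hex
      rw [hK, ← hh_iter _ a (hA_Q a ha)]
      conv_rhs => rw [← Nat.sub_add_cancel hle, Function.iterate_add_apply, hh_fix _ _ hmem]
    obtain ⟨i, hi, hi'⟩ := hfirst a ha
    obtain ⟨j, hj, hj'⟩ := hfirst b hb
    exact eq_of_iterate_eq_of_notMem hg_inj hg_A ha hb i j hi hj (by rw [hi', hj', hab])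

namespace PowerGrid

open Matrix

variable {N L : Type*} [DecidableEq N] (G : PowerGrid N L)

/-! ### The weighted Laplacian -/

theorem sum_mul_incidence [Fintype N] (l : L) (θ : N → ℝ) :
    ∑ n, θ n * G.incidence l n = θ (G.src l) - θ (G.dst l) := by
  have h (n : N) : θ n * G.incidence l n =
      (if n = G.src l then θ n else 0) - (if n = G.dst l then θ n else 0) := by
    have := G.src_ne_dst l
    unfold incidence
    split_ifs with h1 h2 <;> simp_all
  simp [h]

variable [Fintype L]

/-- The Laplacian for arbitrary line weights `y`, the inverses of the reactances. The weights may
vanish or be the indeterminates of a polynomial ring over `ℝ`. -/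
def weightedLaplacian {R : Type*} [CommRing R] [Algebra ℝ R] (y : L → R) : Matrix N N R :=
  ∑ l, y l • (vecMulVec (G.incidence l) (G.incidence l)).map (algebraMap ℝ R)

theorem laplacian_eq_weightedLaplacian (x : L → ℝ) :
    G.laplacian x = G.weightedLaplacian fun l => 1 / x l := by
  simp [laplacian, weightedLaplacian]

theorem map_weightedLaplacian {R S : Type*} [CommRing R] [Algebra ℝ R] [CommRing S] [Algebra ℝ S]
    (φ : R →ₐ[ℝ] S) (y : L → R) :
    (G.weightedLaplacian y).map φ = G.weightedLaplacian fun l => φ (y l) := by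
  ext n m
  simp [weightedLaplacian, Matrix.sum_apply]

variable [Fintype N]

/-- The bilinear form of the Laplacian. -/
theorem dotProduct_weightedLaplacian_mulVec (y : L → ℝ) (φ θ : N → ℝ) :
    φ ⬝ᵥ (G.weightedLaplacian y *ᵥ θ) =
      ∑ l, y l * ((φ (G.src l) - φ (G.dst l)) * (θ (G.src l) - θ (G.dst l))) := by
  simp only [weightedLaplacian, sum_mulVec, dotProduct_sum]
  refine Finset.sum_congr rfl fun l _ => ?_
  rw [← sum_mul_incidence, ← sum_mul_incidence, Algebra.algebraMap_self,
    RingHom.coe_id, Matrix.map_id, smul_mulVec, dotProduct_smul, vecMulVec_mulVec, smul_eq_mul]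
  congr 1
  simp only [dotProduct, Pi.smul_apply, MulOpposite.smul_eq_mul_unop, MulOpposite.unop_op,
    Finset.sum_mul]
  refine Finset.sum_congr rfl fun n _ => ?_
  simp only [Finset.mul_sum]
  exact Finset.sum_congr rfl fun m _ => by ring

theorem weightedLaplacian_mulVec_apply_eq_zero (y : L → ℝ) {θ : N → ℝ} {n : N} (hn : θ n = 0)
    (hadj : ∀ m, G.graph.Adj n m → θ m = 0) : (G.weightedLaplacian y *ᵥ θ) n = 0 := by
  have h := G.dotProduct_weightedLaplacian_mulVec y (Pi.single n 1) θ
  rw [single_one_dotProduct] at h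
  rw [h]
  refine Finset.sum_eq_zero fun l _ => ?_
  by_cases hs : G.src l = n
  · rw [hs, hn, hadj _ ⟨l, Or.inl ⟨hs, rfl⟩⟩]; simp
  · by_cases hd : G.dst l = n
    · rw [hd, hn, hadj _ ⟨l, Or.inr ⟨rfl, hd⟩⟩]; simp
    · simp [hs, hd]

/-- Nonnegative weights make the quadratic form a sum of nonnegative terms, which vanish together
with it. -/
theorem eq_of_weightedLaplacian_mulVec_eq_zero {y : L → ℝ} (hy : ∀ l, 0 ≤ y l) {θ : N → ℝ}
    (h : G.weightedLaplacian y *ᵥ θ = 0) {l : L} (hl : y l ≠ 0) :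
    θ (G.src l) = θ (G.dst l) := by
  have hq := G.dotProduct_weightedLaplacian_mulVec y θ θ
  rw [h, dotProduct_zero, eq_comm, Finset.sum_eq_zero_iff_of_nonneg fun l _ =>
    mul_nonneg (hy l) (mul_self_nonneg _)] at hq
  have := hq l (Finset.mem_univ l)
  rcases mul_eq_zero.1 this with h0 | h0
  · exact absurd h0 hl
  · exact sub_eq_zero.1 (mul_self_eq_zero.1 h0)

theorem eq_zero_of_weightedLaplacian_mulVec_eq_zero (hG : G.graph.Connected) {y : L → ℝ}
    (hy : ∀ l, 0 < y l) {θ : N → ℝ} (h : G.weightedLaplacian y *ᵥ θ = 0) {m : N} (hm : θ m = 0) :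
    θ = 0 := by
  funext n
  obtain ⟨p⟩ := hG.preconnected n m
  induction p with
  | nil => exact hm
  | cons hadj _ ih =>
    obtain ⟨l, ⟨rfl, rfl⟩ | ⟨rfl, rfl⟩⟩ := hadj
    · exact (G.eq_of_weightedLaplacian_mulVec_eq_zero (fun l => (hy l).le) h (hy l).ne').trans
        (ih hm)
    · exact (G.eq_of_weightedLaplacian_mulVec_eq_zero (fun l => (hy l).le) h (hy l).ne').symm.trans
        (ih hm)

/-! ### Attacks supported on a given set of buses -/

/-- For the line weights `y`, no nonzero state change vanishes on `M` and alters the power injection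
on `A` only. -/
def NoAttackOn (y : L → ℝ) (M A : Finset N) : Prop :=
  ∀ θ : N → ℝ, (∀ n ∈ M, θ n = 0) → (∀ n ∉ A, (G.weightedLaplacian y *ᵥ θ) n = 0) → θ = 0

/-- The matrix of the quadratic form `θ ↦ ∑ n ∉ A, ((B θ) n)² + ∑ n ∈ M, (θ n)²` for the line
weights `y`. It is invertible exactly when there is no attack on `A`, and its entries are
polynomials in the weights. -/
def attackMatrix {R : Type*} [CommRing R] [Algebra ℝ R] (y : L → R) (M A : Finset N) :
    Matrix N N R :=
  (G.weightedLaplacian y)ᵀ * (diagonal (fun n => if n ∈ A then 0 else 1) * G.weightedLaplacian y) +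
    diagonal fun n => if n ∈ M then 1 else 0

theorem map_attackMatrix {R S : Type*} [CommRing R] [Algebra ℝ R] [CommRing S] [Algebra ℝ S]
    (φ : R →ₐ[ℝ] S) (y : L → R) (M A : Finset N) :
    (G.attackMatrix y M A).map φ = G.attackMatrix (fun l => φ (y l)) M A := by
  have h := G.map_weightedLaplacian φ y
  unfold attackMatrix
  rw [Matrix.map_add φ (map_add φ), Matrix.map_mul, Matrix.map_mul, ← h, Matrix.transpose_map,
    diagonal_map (map_zero φ), diagonal_map (map_zero φ)]
  congr <;> funext n <;> simp [apply_ite φ]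

theorem det_attackMatrix_ne_zero_iff {y : L → ℝ} {M A : Finset N} :
    (G.attackMatrix y M A).det ≠ 0 ↔ G.NoAttackOn y M A := by
  rw [Ne, ← exists_mulVec_eq_zero_iff]
  push Not
  have hmul (θ : N → ℝ) : G.attackMatrix y M A *ᵥ θ =
      (G.weightedLaplacian y)ᵀ *ᵥ
        (fun n => if n ∈ A then 0 else (G.weightedLaplacian y *ᵥ θ) n) +
      fun n => if n ∈ M then θ n else 0 := by
    simp only [attackMatrix, add_mulVec, ← mulVec_mulVec]
    congr 1
    · congr 1
      funext n
      simp [mulVec_diagonal]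
    · funext n
      simp [mulVec_diagonal]
  constructor
  · intro h θ hM hA
    by_contra hθ
    refine h θ hθ ?_
    rw [hmul]
    have h1 : (fun n => if n ∈ A then 0 else (G.weightedLaplacian y *ᵥ θ) n) = 0 := by
      funext n
      by_cases hn : n ∈ A <;> simp [hn, hA]
    have h2 : (fun n => if n ∈ M then θ n else 0) = 0 := by
      funext n
      by_cases hn : n ∈ M <;> simp [hn, hM]
    rw [h1, h2, mulVec_zero, add_zero]
  · intro h θ hθ h0
    have hq : θ ⬝ᵥ (G.attackMatrix y M A *ᵥ θ) = 0 := by rw [h0, dotProduct_zero]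
    rw [hmul, dotProduct_add, dotProduct_mulVec, vecMul_transpose] at hq
    have e1 : 0 ≤ ∑ n, (G.weightedLaplacian y *ᵥ θ) n *
        (if n ∈ A then 0 else (G.weightedLaplacian y *ᵥ θ) n) :=
      Finset.sum_nonneg fun n _ => by split_ifs <;> simp [mul_self_nonneg]
    have e2 : 0 ≤ ∑ n, θ n * (if n ∈ M then θ n else 0) :=
      Finset.sum_nonneg fun n _ => by split_ifs <;> simp [mul_self_nonneg]
    simp only [dotProduct] at hq
    have e1' := (Finset.sum_eq_zero_iff_of_nonneg fun n _ => by
      split_ifs <;> simp [mul_self_nonneg]).1 (le_antisymm (by linarith) e1)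
    have e2' := (Finset.sum_eq_zero_iff_of_nonneg fun n _ => by
      split_ifs <;> simp [mul_self_nonneg]).1 (le_antisymm (by linarith) e2)
    refine hθ (h θ (fun n hn => ?_) fun n hn => ?_)
    · simpa [hn] using e2' n (Finset.mem_univ n)
    · simpa [hn] using e1' n (Finset.mem_univ n)

/-- Give weight `1` to the lines with both ends in the same tree of the forest with parent map `h`,
and weight `0` to the others. The injections into each tree add up to zero, and at most one of them
may be nonzero, so all are zero; then the state is constant on each tree and equal to its value at
the root, which is zero. -/
theorem exists_noAttackOn_of_parent_map {M A : Finset N} {h : N → N} {K : ℕ}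
    (hM : ∀ m ∈ M, h m = m) (hadj : ∀ v ∉ M, G.graph.Adj v (h v)) (hK : ∀ v, h^[K] v ∈ M)
    (hA : Set.InjOn h^[K] A) : ∃ y : L → ℝ, G.NoAttackOn y M A := by
  classical
  let y : L → ℝ := fun l => if h^[K] (G.src l) = h^[K] (G.dst l) then 1 else 0
  have hroot : ∀ v, h^[K] (h v) = h^[K] v := fun v => by
    rw [← Function.iterate_succ_apply, Function.iterate_succ_apply', hM _ (hK v)]
  refine ⟨y, fun θ hθM hθA => ?_⟩
  have hzero : G.weightedLaplacian y *ᵥ θ = 0 := by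
    funext a
    by_cases ha : a ∈ A
    swap
    · exact hθA a ha
    have hsum := G.dotProduct_weightedLaplacian_mulVec y
      (fun n => if h^[K] n = h^[K] a then 1 else 0) θ
    rw [Finset.sum_eq_zero, dotProduct, Finset.sum_eq_single a] at hsum
    · simpa using hsum
    · intro b _ hb
      by_cases hbA : b ∈ A
      · rw [if_neg fun hab => hb (hA hbA ha hab), zero_mul]
      · rw [hθA b hbA, mul_zero]
    · simp
    · intro l _
      by_cases hl : h^[K] (G.src l) = h^[K] (G.dst l)
      · simp [hl]
      · simp [y, hl]
  have hconst : ∀ v, θ v = θ (h v) := by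
    intro v
    by_cases hv : v ∈ M
    · rw [hM v hv]
    · have hy : ∀ l, 0 ≤ y l := fun l => by simp only [y]; split_ifs <;> norm_num
      obtain ⟨l, ⟨h1, h2⟩ | ⟨h1, h2⟩⟩ := hadj v hv
      · have hl : y l ≠ 0 := by simp [y, h1, h2, hroot]
        simpa [h1, h2] using G.eq_of_weightedLaplacian_mulVec_eq_zero hy hzero hl
      · have hl : y l ≠ 0 := by simp [y, h1, h2, hroot]
        simpa [h1, h2] using (G.eq_of_weightedLaplacian_mulVec_eq_zero hy hzero hl).symm
  have hiter : ∀ k v, θ v = θ (h^[k] v) := by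
    intro k
    induction k with
    | zero => intro v; rfl
    | succ k ih => intro v; rw [Function.iterate_succ_apply, ← ih, hconst]
  funext v
  rw [hiter K v, hθM _ (hK v)]
  rfl

end PowerGrid

/-! ### Vertex cuts of the augmented graph -/

/-- If a vertex set `S` avoids `M`, then its outer boundary is a vertex cut of the augmented graph
that disconnects `S` from `M̄`. -/
theorem separatedFrom_of_disjoint {V : Type*} [Fintype V] [DecidableEq V]
    (H : SimpleGraph V) {S M : Finset V} (hSM : Disjoint S M) {v : V} (hv : v ∈ S) :
    some v ∈ separatedFrom (augmentedGraph H M) (augmentedSet M)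
      ((H.closedNeighborFinset S \ S).map Function.Embedding.some) := by
  have hclosed : ∀ u w, (removeVertices (augmentedGraph H M)
      ((H.closedNeighborFinset S \ S).map Function.Embedding.some)).Reachable u w →
      (∃ n ∈ S, u.1 = some n) → ∃ n ∈ S, w.1 = some n := by
    rintro u w ⟨p⟩
    induction p with
    | nil => exact id
    | @cons a b c hab _ ih =>
      rintro ⟨n, hn, hna⟩
      refine ih ?_
      have hab' : (augmentedGraph H M).Adj a.1 b.1 := hab
      rcases hab' with ⟨n', m, ha, hb, hadj⟩ | ⟨-, ha, -⟩
      · obtain rfl : n = n' := Option.some.inj (hna.symm.trans ha)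
        refine ⟨m, ?_, hb⟩
        by_contra hm
        refine b.2 ?_
        rw [hb]
        exact Finset.mem_map_of_mem _ (Finset.mem_sdiff.2
          ⟨SimpleGraph.mem_closedNeighborFinset.2 ⟨n, hn, Or.inr hadj⟩, hm⟩)
      · rw [hna] at ha
        rcases ha with ha | ⟨n', hn', ha⟩
        · exact absurd ha (by simp)
        · obtain rfl := Option.some.inj ha
          exact absurd hn' (Finset.disjoint_left.1 hSM hn)
  refine ⟨by simp [hv], fun t ht htM hreach => ?_⟩
  obtain ⟨n, hn, hnt⟩ := hclosed _ _ hreach ⟨v, hv, rfl⟩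
  have hnt' : t = some n := hnt
  rcases htM with h | ⟨n', hn', h⟩
  · rw [h] at hnt'; exact absurd hnt' (by simp)
  · obtain rfl := Option.some.inj (hnt'.symm.trans h)
    exact Finset.disjoint_left.1 hSM hn hn'

/-- The outer boundary of a violator of Hall's condition is a vulnerable vertex cut. -/
theorem vulnerableVertexConnectivity_add_one_le {V : Type*} [Fintype V] [DecidableEq V]
    (H : SimpleGraph V) {M U A S : Finset V} (hAU : Disjoint A U) (hSM : Disjoint S M)
    (hS : (H.closedNeighborFinset S \ A).card < S.card) :
    vulnerableVertexConnectivity H M U + 1 ≤ A.card := by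
  let C : Finset (Option V) := (H.closedNeighborFinset S \ S).map Function.Embedding.some
  have hC : C.card + S.card = (H.closedNeighborFinset S).card := by
    rw [Finset.card_map, Finset.card_sdiff_add_card_eq_card (H.subset_closedNeighborFinset S)]
  have hA := Finset.card_sdiff_add_card_inter (H.closedNeighborFinset S) A
  have hle : (H.closedNeighborFinset S ∩ A).card ≤ A.card :=
    Finset.card_le_card Finset.inter_subset_right
  have hvul : IsVulnerableVertexCut H M U C := by
    refine ⟨fun hpre => ?_, ?_⟩
    · obtain ⟨v, hv⟩ := Finset.card_pos.1 (by omega : 0 < S.card)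
      obtain ⟨hvC, hsep⟩ := separatedFrom_of_disjoint H hSM hv
      exact hsep none (by simp) (Or.inl rfl) (hpre _ _)
    · have hsub : ((H.closedNeighborFinset S ∩ A : Finset V) : Set V) ⊆ {n : V | n ∉ U ∧ some n ∈
          separatedFrom (augmentedGraph H M) (augmentedSet M) C ∪ (C : Set (Option V))} := by
        intro n hn
        obtain ⟨hnS, hnA⟩ := Finset.mem_inter.1 (Finset.mem_coe.1 hn)
        refine ⟨Finset.disjoint_left.1 hAU hnA, ?_⟩
        by_cases h : n ∈ S
        · exact Or.inl (separatedFrom_of_disjoint H hSM h)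
        · exact Or.inr (Finset.mem_coe.2 (Finset.mem_map_of_mem _ (Finset.mem_sdiff.2 ⟨hnS, h⟩)))
      have := Set.ncard_le_ncard hsub (Set.toFinite _)
      rw [Set.ncard_coe_finset] at this
      omega
  have h1 : vulnerableVertexConnectivity H M U ≤ C.card := iInf₂_le C hvul
  calc vulnerableVertexConnectivity H M U + 1 ≤ (C.card : ℕ∞) + 1 := by gcongr
    _ ≤ A.card := by exact_mod_cast (by omega : C.card + 1 ≤ A.card)

/-- A vulnerable vertex cut `C` of the augmented graph gives a cut `D` of the graph itself with at
most as many elements: the dummy bus can be dropped from `C`. -/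
theorem IsVulnerableVertexCut.exists_separation {V : Type*} [Fintype V]
    {H : SimpleGraph V} {M U : Finset V} {C : Finset (Option V)}
    (hC : IsVulnerableVertexCut H M U C) :
    ∃ S D A : Finset V, Disjoint S M ∧ (∀ v ∈ S, ∀ w, H.Adj v w → w ∈ S ∨ w ∈ D) ∧
      D.card ≤ C.card ∧ Disjoint A U ∧ A.card = C.card + 1 ∧ ∀ v ∈ A, v ∈ S ∨ v ∈ D := by
  classical
  let T := separatedFrom (augmentedGraph H M) (augmentedSet M) C
  obtain ⟨A, hA, hA_card⟩ := Set.exists_subset_card_eq hC.2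
  have hAfin : A.Finite := Set.toFinite A
  refine ⟨Finset.univ.filter fun v => some v ∈ T, Finset.univ.filter fun v => some v ∈ C,
    hAfin.toFinset, ?_, ?_, ?_, ?_, ?_, ?_⟩
  · rw [Finset.disjoint_left]
    intro v hv hvM
    obtain ⟨hvC, hsep⟩ := (Finset.mem_filter.1 hv).2
    exact hsep (some v) hvC (Or.inr ⟨v, hvM, rfl⟩) (SimpleGraph.Reachable.refl _)
  · intro v hv w hvw
    by_cases hw : some w ∈ C
    · right; simpa using hw
    · left
      obtain ⟨hvC, hsep⟩ := (Finset.mem_filter.1 hv).2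
      refine Finset.mem_filter.2 ⟨Finset.mem_univ _, hw, fun t ht htM hreach => ?_⟩
      refine hsep t ht htM (SimpleGraph.Reachable.trans (SimpleGraph.Adj.reachable ?_) hreach)
      exact Or.inl ⟨v, w, rfl, rfl, hvw⟩
  · rw [← Finset.card_map Function.Embedding.some]
    refine Finset.card_le_card fun u hu => ?_
    obtain ⟨v, hv, rfl⟩ := Finset.mem_map.1 hu
    simpa using hv
  · rw [Finset.disjoint_left]
    intro v hv
    exact (hA (by simpa using hv)).1
  · rw [← hA_card, Set.ncard_eq_toFinset_card A hAfin]
  · intro v hv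
    simpa [T] using (hA (by simpa using hv)).2

/-! ### Minimum sparsity of unobservable attacks -/

namespace PowerGrid

open Matrix

variable {N L : Type*} [Fintype N] [DecidableEq N] [Fintype L] (G : PowerGrid N L)

/-- A state change supported on `S` only alters injections on `S ∪ D`. Asking that it alters none
outside `A` amounts to at most `|S| + |D| - |A| < |S|` linear equations, so there is a nonzero
solution. -/
theorem exists_ne_zero_mulVec_eq_zero {S D A : Finset N}
    (hSD : ∀ v ∈ S, ∀ w, G.graph.Adj v w → w ∈ S ∨ w ∈ D) (hDA : D.card < A.card)
    (hA : ∀ v ∈ A, v ∈ S ∨ v ∈ D) (y : L → ℝ) :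
    ∃ θ : N → ℝ, θ ≠ 0 ∧ (∀ n ∉ S, θ n = 0) ∧
      ∀ n ∉ A, (G.weightedLaplacian y *ᵥ θ) n = 0 := by
  let extend : (S → ℝ) →ₗ[ℝ] (N → ℝ) :=
    { toFun := fun u n => if hn : n ∈ S then u ⟨n, hn⟩ else 0
      map_add' := fun u v => by funext n; by_cases hn : n ∈ S <;> simp [hn]
      map_smul' := fun c u => by funext n; by_cases hn : n ∈ S <;> simp [hn] }
  let F : (S → ℝ) →ₗ[ℝ] (((S ∪ D) \ A : Finset N) → ℝ) :=
    (LinearMap.funLeft ℝ ℝ Subtype.val) ∘ₗ (G.weightedLaplacian y).mulVecLin ∘ₗ extend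
  have hrank : Module.finrank ℝ (((S ∪ D) \ A : Finset N) → ℝ) < Module.finrank ℝ (S → ℝ) := by
    rw [Module.finrank_fintype_fun_eq_card, Module.finrank_fintype_fun_eq_card,
      Fintype.card_coe, Fintype.card_coe]
    have h1 : A ⊆ S ∪ D := fun v hv => Finset.mem_union.2 (hA v hv)
    have h2 := Finset.card_sdiff_add_card_eq_card h1
    have h3 := Finset.card_union_le S D
    omega
  obtain ⟨u, hu, hu0⟩ :=
    (Submodule.ne_bot_iff _).1 (LinearMap.ker_ne_bot_of_finrank_lt (f := F) hrank)
  have hout : ∀ n ∉ S, extend u n = 0 := fun n hn => by simp [extend, hn]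
  refine ⟨extend u, fun h0 => hu0 ?_, hout, fun n hn => ?_⟩
  · funext n
    simpa [extend] using congrFun h0 n.1
  · by_cases hnSD : n ∈ S ∪ D
    · exact congrFun (LinearMap.mem_ker.1 hu) ⟨n, Finset.mem_sdiff.2 ⟨hnSD, hn⟩⟩
    · rw [Finset.mem_union, not_or] at hnSD
      refine G.weightedLaplacian_mulVec_apply_eq_zero y (hout n hnSD.1) fun m hm => ?_
      refine hout m fun hmS => ?_
      exact (hSD m hmS n hm.symm).elim hnSD.1 hnSD.2

/-- Every unobservable attack is at least as expensive as a vulnerable cut, provided that the line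
weights are generic: no attack on `A` exists for them unless it exists for all weights. -/
theorem vulnerableVertexConnectivity_add_one_le_hammingNorm (hG : G.graph.Connected)
    {M U : Finset N} (hM : M.Nonempty) {y : L → ℝ}
    (hy : ∀ A : Finset N, (∃ y₀ : L → ℝ, G.NoAttackOn y₀ M A) → G.NoAttackOn y M A)
    {θ : N → ℝ} (hθ : θ ≠ 0) (hθM : ∀ n ∈ M, θ n = 0)
    (hθU : ∀ n ∈ U, (G.weightedLaplacian y *ᵥ θ) n = 0) :
    vulnerableVertexConnectivity G.graph M U + 1 ≤
      (hammingNorm (G.weightedLaplacian y *ᵥ θ) : ℕ∞) := by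
  let A : Finset N := {n | (G.weightedLaplacian y *ᵥ θ) n ≠ 0}
  have hA : ∀ n ∉ A, (G.weightedLaplacian y *ᵥ θ) n = 0 := fun n hn => by simpa [A] using hn
  have hAU : Disjoint A U := Finset.disjoint_left.2 fun n hn hnU =>
    (Finset.mem_filter.1 hn).2 (hθU n hnU)
  rcases G.graph.exists_injective_or_card_lt M A with ⟨f, hf_inj, hf⟩ | ⟨S, hSM, hS⟩
  · obtain ⟨h, K, h1, h2, h3, h4⟩ := hG.exists_parent_map hM hf_inj hf
    exact absurd (hy A (G.exists_noAttackOn_of_parent_map h1 h2 h3 h4) θ hθM hA) hθ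
  · exact vulnerableVertexConnectivity_add_one_le G.graph hAU hSM hS

/-- For every vulnerable cut there is an attack, and its support consists of at most one bus more
than the cut. -/
theorem exists_hammingNorm_le (hG : G.graph.Connected) {M U : Finset N} (hM : M.Nonempty)
    {y : L → ℝ} (hy : ∀ l, 0 < y l) {C : Finset (Option N)}
    (hC : IsVulnerableVertexCut G.graph M U C) :
    ∃ θ : N → ℝ, θ ≠ 0 ∧ G.weightedLaplacian y *ᵥ θ ≠ 0 ∧ (∀ n ∈ M, θ n = 0) ∧
      (∀ n ∈ U, (G.weightedLaplacian y *ᵥ θ) n = 0) ∧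
      hammingNorm (G.weightedLaplacian y *ᵥ θ) ≤ C.card + 1 := by
  obtain ⟨S, D, A, hSM, hSD, hDC, hAU, hA_card, hA⟩ := hC.exists_separation
  obtain ⟨θ, hθ, hθS, hθA⟩ := G.exists_ne_zero_mulVec_eq_zero hSD (by omega) hA y
  obtain ⟨m, hm⟩ := hM
  have hθM : ∀ n ∈ M, θ n = 0 := fun n hn => hθS n fun hnS => Finset.disjoint_left.1 hSM hnS hn
  refine ⟨θ, hθ, fun h => hθ ?_, hθM, fun n hn => hθA n fun hnA =>
    Finset.disjoint_left.1 hAU hnA hn, ?_⟩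
  · exact G.eq_zero_of_weightedLaplacian_mulVec_eq_zero hG hy h (hθM m hm)
  · rw [← hA_card]
    refine Finset.card_le_card fun n hn => ?_
    by_contra hnA
    exact (Finset.mem_filter.1 hn).2 (hθA n hnA)

/-- Both minima equal the vulnerable connectivity plus one as soon as the reactances are positive
and the line weights are generic. -/
theorem minAttackSparsity_eq_and_sparsestAttackOptimum_eq (hG : G.graph.Connected)
    {M U : Finset N} (hM : M.Nonempty) {x : L → ℝ} (hx : ∀ l, 0 < x l)
    (hgen : ∀ A : Finset N, (∃ y₀ : L → ℝ, G.NoAttackOn y₀ M A) →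
      G.NoAttackOn (fun l => 1 / x l) M A) :
    G.minAttackSparsity x M U = vulnerableVertexConnectivity G.graph M U + 1 ∧
      G.sparsestAttackOptimum x M U = vulnerableVertexConnectivity G.graph M U + 1 := by
  have hcut : ∀ C, IsVulnerableVertexCut G.graph M U C → ∃ θ : N → ℝ, θ ≠ 0 ∧
      G.laplacian x *ᵥ θ ≠ 0 ∧ (∀ n ∈ M, θ n = 0) ∧ (∀ n ∈ U, (G.laplacian x *ᵥ θ) n = 0) ∧
      hammingNorm (G.laplacian x *ᵥ θ) ≤ C.card + 1 := fun C hC => by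
    rw [laplacian_eq_weightedLaplacian]
    exact G.exists_hammingNorm_le hG hM (fun l => one_div_pos.2 (hx l)) hC
  have hattack : ∀ θ : N → ℝ, θ ≠ 0 → (∀ n ∈ M, θ n = 0) →
      (∀ n ∈ U, (G.laplacian x *ᵥ θ) n = 0) →
      vulnerableVertexConnectivity G.graph M U + 1 ≤
        (hammingNorm (G.laplacian x *ᵥ θ) : ℕ∞) := fun θ h0 h1 h2 => by
    rw [laplacian_eq_weightedLaplacian] at h2 ⊢
    exact G.vulnerableVertexConnectivity_add_one_le_hammingNorm hG hM hgen h0 h1 h2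
  refine ⟨le_antisymm ?_ (le_iInf₂ ?_), le_antisymm ?_ (le_iInf₂ ?_)⟩
  · rw [vulnerableVertexConnectivity]
    simp only [ENat.iInf_add]
    refine le_iInf₂ fun C hC => ?_
    obtain ⟨θ, -, hne, hθM, hθU, hle⟩ := hcut C hC
    exact (iInf₂_le _ ⟨hne, hθU, θ, rfl, hθM⟩).trans (by exact_mod_cast hle)
  · rintro _ ⟨hne, hU, θ, rfl, hθM⟩
    exact hattack θ (fun h0 => hne (by rw [h0, mulVec_zero])) hθM hU
  · rw [vulnerableVertexConnectivity]
    simp only [ENat.iInf_add]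
    refine le_iInf₂ fun C hC => ?_
    obtain ⟨θ, hθ, -, hθM, hθU, hle⟩ := hcut C hC
    exact (iInf₂_le θ ⟨hθ, hθM, hθU⟩).trans (by exact_mod_cast hle)
  · rintro θ ⟨hθ, hθM, hθU⟩
    exact hattack θ hθ hθM hθU

/-- Independent line weights with continuous distributions are almost surely generic, since the
determinant of the attack matrix is a polynomial in the weights. -/
theorem ae_noAttackOn {Ω : Type*} [MeasurableSpace Ω] {P : Measure Ω} [IsProbabilityMeasure P]
    {y : L → Ω → ℝ} (hy_meas : ∀ l, Measurable (y l)) (hy_indep : iIndepFun y P)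
    (hy_cont : ∀ l, ∀ c : ℝ, P {ω | y l ω = c} = 0) (M A : Finset N)
    (hA : ∃ y₀ : L → ℝ, G.NoAttackOn y₀ M A) :
    ∀ᵐ ω ∂P, G.NoAttackOn (fun l => y l ω) M A := by
  let p : MvPolynomial L ℝ := (G.attackMatrix MvPolynomial.X M A).det
  have hp (z : L → ℝ) : MvPolynomial.eval z p = (G.attackMatrix z M A).det := by
    have h := G.map_attackMatrix (MvPolynomial.aeval z) MvPolynomial.X M A
    simp only [MvPolynomial.aeval_X] at h
    rw [← h, ← MvPolynomial.coe_aeval_eq_eval]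
    exact AlgHom.map_det (MvPolynomial.aeval z) _
  obtain ⟨y₀, hy₀⟩ := hA
  filter_upwards [MvPolynomial.ae_eval_ne_zero_of_iIndepFun hy_meas hy_indep hy_cont (p := p)
    ⟨y₀, by rw [hp]; exact G.det_attackMatrix_ne_zero_iff.2 hy₀⟩] with ω hω
  rw [hp] at hω
  exact G.det_attackMatrix_ne_zero_iff.1 hω

end PowerGrid

theorem theorem2 {N L Ω : Type*} [Fintype N] [DecidableEq N] [Fintype L]
    (G : PowerGrid N L) (hG : G.graph.Connected)
    [MeasurableSpace Ω] (P : Measure Ω) [IsProbabilityMeasure P]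
    (x : L → Ω → ℝ) (hx_meas : ∀ l, Measurable (x l))
    (hx_indep : iIndepFun x P)
    (hx_cont : ∀ l, ∀ c : ℝ, P {ω | x l ω = c} = 0)
    (hx_bdd : ∃ ε : ℝ, 0 < ε ∧ ∀ l, ∀ᵐ ω ∂P, ε ≤ x l ω)
    (M U : Finset N) (hM : M.Nonempty) :
    ∀ᵐ ω ∂P,
      G.minAttackSparsity (fun l => x l ω) M U
          = vulnerableVertexConnectivity G.graph M U + 1 ∧
      G.sparsestAttackOptimum (fun l => x l ω) M U
          = vulnerableVertexConnectivity G.graph M U + 1 := by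
  obtain ⟨ε, hε, hx_ge⟩ := hx_bdd
  have hinv : Measurable fun t : ℝ => 1 / t := by fun_prop
  have hcont : ∀ l, ∀ c : ℝ, P {ω | 1 / x l ω = c} = 0 := fun l c => by
    simpa only [one_div, inv_eq_iff_eq_inv] using hx_cont l c⁻¹
  have hgen : ∀ A : Finset N, ∀ᵐ ω ∂P, (∃ y₀ : L → ℝ, G.NoAttackOn y₀ M A) →
      G.NoAttackOn (fun l => 1 / x l ω) M A := fun A => by
    by_cases hA : ∃ y₀ : L → ℝ, G.NoAttackOn y₀ M A
    · filter_upwards [G.ae_noAttackOn (fun l => hinv.comp (hx_meas l))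
        (hx_indep.comp (fun _ t => 1 / t) fun _ => hinv) hcont M A hA] with ω hω _
      exact hω
    · exact Filter.Eventually.of_forall fun _ h => absurd h hA
  filter_upwards [ae_all_iff.2 hx_ge, ae_all_iff.2 hgen] with ω hω hωgen
  exact G.minAttackSparsity_eq_and_sparsestAttackOptimum_eq hG hM (fun l => hε.trans_le (hω l))
    hωgen
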